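/- **System.** A network carries a finite set $\mathcal S$ of flows; flow $s$ has a fixed route of $H(s)\ge 1$ links. Let $\mathcal P=\{(s,k): s\in\mathcal S,\ 1\le k\le H(s)\}$ be the set of link-flow pairs, with an arbitrary interference relation. A schedule is a subset of $\mathcal P$, identified with its vector $M\in\{0,1\}^{\mathcal P}$; it is feasible if no two distinct pairs in it interfere. Let $\mathcal M$ be the set of feasible schedules and $Co(\mathcal M)$ its convex hull. A rate vector $\lambda$ is strictly inside $\Lambda^*$ if there is $\phi\in Co(\mathcal M)$ with $\lambda_s<\phi_{s,k}$ for all $(s,k)\in\mathcal P$. Time is slotted. $A_s(t)$ packets of flow $s$ arrive at its source in slot $t$. $Q_{s,k}(t)$ is the length of the first-in first-out queue of $(s,k)$ at the beginning of slot $t$. If $(s,k)$ belongs to the schedule of slot $t$ and $Q_{s,k}(t)>0$, then one packet moves in that slot from the queue of $(s,k)$ to that of $(s,k+1)$, or leaves the network if $k=H(s)$. At time $0$ the system contains $x$ packets, all of them in the first queues of their flows, and they arrived at times in $\{-(x-1),\dots,0\}$. Let $F_s(t)$ be the number of packets of flow $s$ that have arrived by time $t$, those present at time $0$ included, and $\hat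 F_{s,k}(t)$ the number of packets served at $(s,k)$ in the slots before $t$, so that $\hat F_{s,k}(0)=0$. Let $W_{s,k}(t)$ be the time elapsed since the head-of-line packet of the queue of $(s,k)$ arrived in the network, with $W_{s,k}(t)=W_{s,k-1}(t)$ if that queue is empty, $W_{s,0}=0$ and $W_{s,H(s)+1}=W_{s,H(s)}$. Put $\hat W_{s,k}=W_{s,k}-W_{s,k-1}$ and $\Delta\hat W_{s,k}=\hat W_{s,k}-\hat W_{s,k+1}$. The delay-based back-pressure policy (D-BP) uses in every slot $t$ a schedule that maximizes $\sum_{(s,k)\in\mathcal P}\Delta\hat W_{s,k}(t)\,M_{s,k}$ over $M\in\mathcal M$, with ties broken arbitrarily. **Arrivals and fluid limits.** Let $A^{(x)}$ be the arrival process of the systems started with $x$ packets. Assume that, with probability $1$, $\frac1t\sum_{\tau<t}A^{(x)}_s(\tau)\to\lambda_s$ as $t\to\infty$ for all $x$ and $s$, and that the fluid limits of the arrivals exist: with probability $1$, $\frac1x\int_0^{xt}A^{(x)}_s(\lfloor\tau\rfloor)\,d\tau\to\lambda_s t$ as $x\to\infty$, uniformly over compact sets of $t\ge0$, for all $s$.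 For a sequence of systems with initial numbers of packets $x_n\to\infty$, a fluid limit is a limit, along a common subsequence, of the scaled processes: $\frac1{x_n}F_s(x_nt)\to f_s(t)$ and $\frac1{x_n}\hat F_{s,k}(x_nt)\to\hat f_{s,k}(t)$ uniformly over compact sets of $t\ge 0$, and likewise for the queue lengths, their partial sums along routes, and the cumulative offered and actual service, while $\frac1{x_n}W_{s,k}(x_nt)$ and $\frac1{x_n}U_{s,k}(x_nt)$, where $U_{s,k}(t)=t-W_{s,k}(t)$ in slot $t$, converge at all continuity points of their limits (every process $Y$ is extended from slots to continuous time by $Y(t)=Y(\lfloor t\rfloor)$). **Lemma.** Suppose that $\lambda_s>0$ for all $s$ and that $\lambda$ is strictly inside $\Lambda^*$. Then there is a finite time $T>0$, depending only on the network and $\lambda$, such that with probability $1$ the following holds: for every sequence of systems under D-BP with initial numbers of packets tending to infinity, every fluid limit satisfies $$\hat f_{s,k}(T)>f_s(0)\qquad\text{for all }(s,k)\in\mathcal P.$$ -/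

import Mathlib

open Filter Topology MeasureTheory

noncomputable section

namespace DelayBP

/-- A multi-hop wireless network with a finite set `S` of flows, seen through its flows:
flow `s` has a fixed route of `hop s` links, and `interferes` says which
link-flow-pairs (`k`-th hop of flow `s`) interfere. -/
structure Network (S : Type*) where
  /-- number of hops of the route of a flow -/
  hop : S → ℕ
  one_le_hop : ∀ s, 1 ≤ hop s
  /-- the (arbitrary) interference relation between link-flow-pairs -/
  interferes : (Σ s : S, Finset.Icc 1 (hop s)) → (Σ s : S, Finset.Icc 1 (hop s)) → Prop

namespace Network

variable {S : Type*} (N : Network S)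

/-- Link-flow-pairs `(s, k)` with `1 ≤ k ≤ hop s`. -/
abbrev Pair : Type _ := Σ s : S, Finset.Icc 1 (N.hop s)

/-- `I(s,k)`: the pairs that interfere with `(s,k)`, and `(s,k)` itself. -/
def interferenceSet (p : N.Pair) : Set N.Pair := {r | N.interferes p r ∨ r = p}

/-- A schedule (the set of its active pairs) is feasible if no two (distinct) active pairs
interfere with each other. -/
def Feasible (M : Set N.Pair) : Prop :=
  M.Pairwise fun p r => r ∉ N.interferenceSet p

/-- The `0-1` vector of a schedule. -/
def vec (M : Set N.Pair) : N.Pair → ℝ := M.indicator 1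

/-- The convex hull of the feasible schedules. -/
def scheduleHull : Set (N.Pair → ℝ) := convexHull ℝ (N.vec '' {M | N.Feasible M})

/-- `lam` is strictly inside the optimal throughput region. -/
def StrictlyInside (lam : S → ℝ) : Prop :=
  ∃ phi ∈ N.scheduleHull, ∀ p : N.Pair, lam p.1 < phi p

/-- The primitive data of one sample path of the system: the initial configuration, the arrivals
and the schedules used. Everything else is computed from these below. -/
structure SamplePath [Fintype S] where
  /-- number of packets in the system at time slot `0` -/
  size : ℕ
  /-- `init s d` is the number of packets of flow `s` that are present at time slot `0` and have
  then been in the network for `d` slots, i.e. that arrived at time `-d`; `d = 0, …, size - 1`.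
  They all wait in the first queue of their flow. -/
  init : S → ℕ → ℕ
  init_total : ∑ s, ∑ d ∈ Finset.range size, init s d = size
  /-- `A s t`: number of packets of flow `s` that arrive at the source in slot `t` -/
  A : S → ℕ → ℕ
  /-- `M t`: the schedule (set of active pairs) in slot `t` -/
  M : ℕ → Set N.Pair

namespace SamplePath

variable {N} [Fintype S] (X : N.SamplePath)

/-- `F_s(τ)`: number of packets of flow `s` that have arrived at the source by the beginning of slot
`τ`; the time `τ` may be negative, for the packets of the initial configuration. -/
def F (s : S) (τ : ℤ) : ℕ :=
  (∑ d ∈ (Finset.range X.size).filter (fun d : ℕ => -(d : ℤ) ≤ τ), X.init s d)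
    + ∑ i ∈ Finset.range τ.toNat, X.A s i

open Classical in
/-- `Π_{s,k}(t)`: the service offered to the queue of `(s,k)` in slot `t`. -/
def service (t : ℕ) (s : S) (k : ℕ) : ℕ :=
  if ∃ h : k ∈ Finset.Icc 1 (N.hop s), (⟨s, ⟨k, h⟩⟩ : N.Pair) ∈ X.M t then 1 else 0

/-- Packets leaving hop `k` of flow `s` in slot `t` if the queue lengths are `q`; hop `0` stands for
the exogenous arrivals. -/
def sent (q : S → ℕ → ℕ) (t : ℕ) (s : S) (k : ℕ) : ℕ :=
  if k = 0 then X.A s t else min (X.service t s k) (q s k)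

/-- `Q_{s,k}(t)`, the queue length of `(s,k)` at the beginning of slot `t`
(`0` unless `1 ≤ k ≤ hop s`). -/
def Q : ℕ → S → ℕ → ℕ
  | 0, s, k => if k = 1 then ∑ d ∈ Finset.range X.size, X.init s d else 0
  | t + 1, s, k =>
      if k ∈ Finset.Icc 1 (N.hop s) then
        Q t s k + X.sent (Q t) t s (k - 1) - X.sent (Q t) t s k
      else 0

/-- `Ψ_{s,k}(t)`: number of packets actually transmitted from the queue of `(s,k)` in slot `t`,
with `Ψ_{s,0} = A_s`. -/
def Psi (t : ℕ) (s : S) (k : ℕ) : ℕ := X.sent (X.Q t) t s k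

/-- `F̂_{s,k}(t)`: number of packets served at `(s,k)` before slot `t`. -/
def Fhat (t : ℕ) (s : S) (k : ℕ) : ℕ := ∑ τ ∈ Finset.range t, X.Psi τ s k

/-- `P_{s,k}(t)`: total length of the first `k` queues of flow `s`. -/
def P (t : ℕ) (s : S) (k : ℕ) : ℕ := ∑ i ∈ Finset.Icc 1 k, X.Q t s i

/-- The time at which the `j`-th packet of flow `s` (`j = 1, 2, …`) arrives in the network. -/
def arrivalTime (s : S) (j : ℕ) : ℤ := sInf {τ : ℤ | j ≤ X.F s τ}

/-- `Z_{s,k,i}(t)`: sojourn time in the network of the `i`-th packet of the (first-in first-out)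
queue of `(s,k)`, `1 ≤ i ≤ Q_{s,k}(t)`: it is the packet number `F̂_{s,k}(t) + i` of its flow. -/
def Z (t : ℕ) (s : S) (k i : ℕ) : ℤ := t - X.arrivalTime s (X.Fhat t s k + i)

/-- `W_{s,k}(t)`: sojourn time in the network of the head-of-line packet of `(s,k)`, with
`W_{s,0} = 0`, `W_{s,hop s + 1} = W_{s,hop s}`, and `W_{s,k} = W_{s,k-1}` for an empty queue. -/
def W (t : ℕ) (s : S) : ℕ → ℤ
  | 0 => 0
  | k + 1 =>
      if k + 1 ≤ N.hop s ∧ X.Q t s (k + 1) ≠ 0 then X.Z t s (k + 1) 1 else W t s k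

/-- `U_{s,k}(t) = t - W_{s,k}(t)`. -/
def U (t : ℕ) (s : S) (k : ℕ) : ℤ := t - X.W t s k

/-- The delay metric `Ŵ_{s,k}(t) = W_{s,k}(t) - W_{s,k-1}(t)`, for `k ≥ 1`. -/
def What (t : ℕ) (s : S) (k : ℕ) : ℤ := X.W t s k - X.W t s (k - 1)

/-- The delay differential `ΔŴ_{s,k}(t) = Ŵ_{s,k}(t) - Ŵ_{s,k+1}(t)`. -/
def dWhat (t : ℕ) (s : S) (k : ℕ) : ℤ := X.What t s k - X.What t s (k + 1)

/-- The weight `∑ ΔŴ_{s,k}(t) M_{s,k}` of a schedule in slot `t`. -/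
def weight (t : ℕ) (M : Set N.Pair) : ℝ :=
  ∑ p : N.Pair, (X.dWhat t p.1 p.2 : ℝ) * N.vec M p

/-- Delay-based back-pressure: in each slot the schedule is a feasible schedule of maximal weight
(ties are broken arbitrarily). -/
def IsDBP : Prop :=
  ∀ t, N.Feasible (X.M t) ∧ ∀ M, N.Feasible M → X.weight t M ≤ X.weight t (X.M t)

end SamplePath

/-- The functions of scaled time that make up a fluid limit. -/
structure FluidFunctions where
  f : S → ℝ → ℝ
  fhat : N.Pair → ℝ → ℝ
  q : N.Pair → ℝ → ℝ
  p : N.Pair → ℝ → ℝ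
  pi : N.Pair → ℝ → ℝ
  psi : N.Pair → ℝ → ℝ
  w : N.Pair → ℝ → ℝ
  u : N.Pair → ℝ → ℝ

end Network

/-- Convergence on `[0, ∞)`, uniformly over compact intervals. -/
def UOC (g : ℕ → ℝ → ℝ) (g' : ℝ → ℝ) : Prop :=
  ∀ K : ℝ, TendstoUniformlyOn g g' atTop (Set.Icc 0 K)

/-- Convergence at every point of `[0, ∞)` at which the limit function is continuous. -/
def ConvAtContinuity (g : ℕ → ℝ → ℝ) (g' : ℝ → ℝ) : Prop :=
  ∀ t : ℝ, 0 ≤ t → ContinuousWithinAt g' (Set.Ici 0) t →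
    Tendsto (fun j => g j t) atTop (𝓝 (g' t))

/-- The fluid scaling `t ↦ Y(x t) / x` of a process `Y` in discrete time, extended to continuous time
by `Y(t) = Y(⌊t⌋)`. -/
def scaled (x : ℕ) (Y : ℕ → ℝ) (t : ℝ) : ℝ := Y ⌊(x : ℝ) * t⌋₊ / x

/-- The scaled integral `t ↦ (∫₀^{x t} Y(τ) dτ) / x` of a process `Y` in discrete time, extended to
continuous time by `Y(t) = Y(⌊t⌋)`. -/
def scaledIntegral (x : ℕ) (Y : ℕ → ℝ) (t : ℝ) : ℝ :=
  (∫ τ in (0 : ℝ)..((x : ℝ) * t), Y ⌊τ⌋₊) / x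

/-- `L` is a fluid limit of the sequence of sample paths `X n`, where `X n` is scaled by its initial
number of packets: all the scaled processes converge to `L` along a common subsequence. -/
def IsFluidLimit {S : Type*} [Fintype S] {N : Network S} (X : ℕ → N.SamplePath)
    (L : N.FluidFunctions) : Prop :=
  ∃ σ : ℕ → ℕ, StrictMono σ ∧
    (∀ s, UOC (fun j => scaled (X (σ j)).size fun t => (X (σ j)).F s t) (L.f s)) ∧
    ∀ r : N.Pair,
      UOC (fun j => scaled (X (σ j)).size fun t => (X (σ j)).Fhat t r.1 r.2) (L.fhat r) ∧
      UOC (fun j => scaled (X (σ j)).size fun t => (X (σ j)).Q t r.1 r.2) (L.q r) ∧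
      UOC (fun j => scaled (X (σ j)).size fun t => (X (σ j)).P t r.1 r.2) (L.p r) ∧
      (∀ t, 0 ≤ t → IntervalIntegrable (L.pi r) volume 0 t) ∧
      UOC (fun j => scaledIntegral (X (σ j)).size fun t => (X (σ j)).service t r.1 r.2)
        (fun t => ∫ τ in (0 : ℝ)..t, L.pi r τ) ∧
      (∀ t, 0 ≤ t → IntervalIntegrable (L.psi r) volume 0 t) ∧
      UOC (fun j => scaledIntegral (X (σ j)).size fun t => (X (σ j)).Psi t r.1 r.2)
        (fun t => ∫ τ in (0 : ℝ)..t, L.psi r τ) ∧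
      ConvAtContinuity
        (fun j => scaled (X (σ j)).size fun t => (X (σ j)).W t r.1 r.2) (L.w r) ∧
      ConvAtContinuity
        (fun j => scaled (X (σ j)).size fun t => (X (σ j)).U t r.1 r.2) (L.u r)

end DelayBP

end

/-! ### Optimality of maximal-weight schedules over the convex hull. -/

namespace DelayBP.Network

variable {S : Type*} {N : Network S}

/-! The argument runs on the unscaled systems, and the fluid limit is taken only at the end. Up to
scaled time T, for large initial size x, arrivals deviate from their mean `lam s * t` by at most x.
Replacing them by this mean in the first queue gives smoothed queues `smoothQ`, which differ from
the true ones by at most x. The head-of-line packet of a hop is the next packet to be served there,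
so its arrival time can be read off the nearly linear arrival curve: delays equal partial sums of
smoothed queues divided by `lam s`, up to O(x) (`abs_W_sub_le`). Hence D-BP is, up to O(x), a
maximal-weight policy for differences of `smoothQ / lam`.

Compare it with service rates `lam s * (1 + eps * k)`, which increase along the route so that every
queue would drain. The quadratic function `∑ smoothQ ^ 2 / lam` then has drift at most `-2 * eps * ∑
smoothQ + O(x)` (`lyapunov_succ_le`), hence stays O(x²) with a constant independent of the horizon
(`exists_lyapunov_le`). So service at each hop lags the line `F(0) + lam s * t` by at most B x
(`exists_le_Fhat`). Since B does not depend on T, one may choose T with `lam s * T > B` and pass to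
the limit. -/

theorem Feasible.mono {M M' : Set N.Pair} (h : N.Feasible M) (hM : M' ⊆ M) : N.Feasible M' :=
  Set.Pairwise.mono hM h

/-- A linear functional is at most its maximum over the feasible schedules on every nonnegative
vector that is dominated by a point of the convex hull of the schedules. -/
theorem exists_feasible_sum_mul_le [Fintype S] {phi phi' : N.Pair → ℝ} (hphi : phi ∈ N.scheduleHull)
    (h0 : ∀ p, 0 ≤ phi' p) (hle : ∀ p, phi' p ≤ phi p) (D : N.Pair → ℝ) :
    ∃ M, N.Feasible M ∧ ∑ p, D p * phi' p ≤ ∑ p, D p * N.vec M p := by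
  -- Positive parts make the functional monotone, so it can pass from `phi'` to `phi`. It is
  -- recovered at a schedule by dropping the pairs of nonpositive weight.
  let g : (N.Pair → ℝ) →ₗ[ℝ] ℝ := ∑ p, (max (D p) 0) • LinearMap.proj p
  have hg : ∀ v, g v = ∑ p, max (D p) 0 * v p := by
    intro v; simp [g]
  have hconv : ConvexOn ℝ (convexHull ℝ (N.vec '' {M | N.Feasible M})) g :=
    g.convexOn (convex_convexHull ℝ _)
  obtain ⟨v, ⟨M, hM, rfl⟩, hv⟩ := hconv.exists_ge_of_mem_convexHull
    (subset_convexHull ℝ _) hphi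
  refine ⟨M ∩ {p | 0 < D p}, Feasible.mono hM Set.inter_subset_left, ?_⟩
  have h1 : ∑ p, D p * phi' p ≤ g phi := by
    rw [hg]
    refine Finset.sum_le_sum fun p _ => ?_
    calc D p * phi' p ≤ max (D p) 0 * phi' p :=
          mul_le_mul_of_nonneg_right (le_max_left _ _) (h0 p)
      _ ≤ _ := mul_le_mul_of_nonneg_left (hle p) (le_max_right _ _)
  have h2 : g (N.vec M) = ∑ p, D p * N.vec (M ∩ {p | 0 < D p}) p := by
    rw [hg]
    refine Finset.sum_congr rfl fun p _ => ?_
    by_cases hp : p ∈ M <;> by_cases hd : 0 < D p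
    · simp [vec, Set.indicator, hp, hd, max_eq_left hd.le]
    · simp [vec, Set.indicator, hp, hd, not_lt.1 hd]
    · simp [vec, Set.indicator, hp]
    · simp [vec, Set.indicator, hp]
  exact h1.trans (hv.trans h2.le)

/-- A schedule of maximal weight is nearly optimal for all nearby weights. -/
theorem sum_mul_le_of_approx_max [Fintype S] {phi phi' : N.Pair → ℝ} (hphi : phi ∈ N.scheduleHull)
    (h0 : ∀ p, 0 ≤ phi' p) (hle : ∀ p, phi' p ≤ phi p) {D w e : N.Pair → ℝ}
    (hDw : ∀ p, |w p - D p| ≤ e p) {M₀ : Set N.Pair}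
    (hmax : ∀ M, N.Feasible M → ∑ p, w p * N.vec M p ≤ ∑ p, w p * N.vec M₀ p) :
    ∑ p, D p * phi' p ≤ ∑ p, D p * N.vec M₀ p + 2 * ∑ p, e p := by
  obtain ⟨M, hM, h⟩ := exists_feasible_sum_mul_le hphi h0 hle D
  have hv : ∀ (M : Set N.Pair) p, 0 ≤ N.vec M p ∧ N.vec M p ≤ 1 := by
    intro M p
    by_cases hp : p ∈ M <;> simp [vec, Set.indicator, hp]
  have h1 : ∑ p, D p * N.vec M p ≤ ∑ p, w p * N.vec M p + ∑ p, e p := by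
    rw [← Finset.sum_add_distrib]
    refine Finset.sum_le_sum fun p _ => ?_
    have := abs_le.1 (hDw p)
    have := hv M p
    nlinarith
  have h2 : ∑ p, w p * N.vec M₀ p ≤ ∑ p, D p * N.vec M₀ p + ∑ p, e p := by
    rw [← Finset.sum_add_distrib]
    refine Finset.sum_le_sum fun p _ => ?_
    have := abs_le.1 (hDw p)
    have := hv M₀ p
    nlinarith
  linarith [hmax M hM]

/-- The slack at the finitely many pairs allows rates that grow by `eps * lam` per hop; this surplus
of each hop over its predecessor is what drains every queue. -/
theorem StrictlyInside.exists_pos_le [Fintype S] {lam : S → ℝ} (hlam : N.StrictlyInside lam) :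
    ∃ eps : ℝ, 0 < eps ∧ ∃ phi ∈ N.scheduleHull, ∀ p : N.Pair,
      lam p.1 * (1 + eps * (p.2 : ℕ)) ≤ phi p := by
  obtain ⟨phi, hphi, hlt⟩ := hlam
  have h : ∀ᶠ eps : ℝ in 𝓝[>] 0, ∀ p : N.Pair, lam p.1 * (1 + eps * (p.2 : ℕ)) ≤ phi p := by
    rw [eventually_all]
    intro p
    have hc : ContinuousAt (fun eps : ℝ => lam p.1 * (1 + eps * ((p.2 : ℕ) : ℝ))) 0 := by fun_prop
    have := hc.eventually_lt_const (u := phi p) (by simpa using hlt p)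
    exact (this.filter_mono nhdsWithin_le_nhds).mono fun _ h => h.le
  obtain ⟨eps, h1, h2⟩ := (h.and self_mem_nhdsWithin).exists
  exact ⟨eps, h2, phi, hphi, h1⟩

/-! ### Arrival times and conservation of packets. -/

namespace SamplePath

variable [Fintype S] (X : N.SamplePath)

theorem F_natCast (s : S) (t : ℕ) :
    X.F s t = ∑ d ∈ Finset.range X.size, X.init s d + ∑ i ∈ Finset.range t, X.A s i := by
  unfold F
  rw [Finset.filter_true_of_mem (by intro d _; omega)]
  simp

theorem F_zero (s : S) : X.F s 0 = ∑ d ∈ Finset.range X.size, X.init s d := by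
  simpa using X.F_natCast s 0

theorem F_zero_le (s : S) : X.F s 0 ≤ X.size := by
  rw [F_zero]
  conv_rhs => rw [← X.init_total]
  exact Finset.single_le_sum (f := fun s => ∑ d ∈ Finset.range X.size, X.init s d)
    (fun _ _ => Nat.zero_le _) (Finset.mem_univ s)

theorem F_mono (s : S) : Monotone (X.F s) := by
  intro a b hab
  unfold F
  gcongr
  exact Int.toNat_le_toNat hab

theorem F_eq_zero (s : S) {τ : ℤ} (h : τ ≤ -(X.size : ℤ)) : X.F s τ = 0 := by
  unfold F
  rw [Finset.filter_false_of_mem, Int.toNat_of_nonpos (by omega)]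
  · simp
  · intro d hd
    have := Finset.mem_range.1 hd
    omega

theorem bddBelow_le_F (s : S) {j : ℕ} (hj : 0 < j) : BddBelow {τ : ℤ | j ≤ X.F s τ} := by
  refine ⟨-X.size, fun τ hτ => ?_⟩
  by_contra! h
  have := X.F_eq_zero s h.le
  have h2 : j ≤ X.F s τ := hτ
  omega

theorem arrivalTime_le (s : S) {j : ℕ} (hj : 0 < j) {τ : ℤ} (h : j ≤ X.F s τ) :
    X.arrivalTime s j ≤ τ :=
  csInf_le (X.bddBelow_le_F s hj) h

theorem le_F_arrivalTime (s : S) {j : ℕ} (hj : 0 < j) {τ : ℤ} (h : j ≤ X.F s τ) :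
    j ≤ X.F s (X.arrivalTime s j) :=
  Int.csInf_mem (s := {τ : ℤ | j ≤ X.F s τ}) ⟨τ, h⟩ (X.bddBelow_le_F s hj)

theorem F_lt_of_lt_arrivalTime (s : S) {j : ℕ} (hj : 0 < j) {τ : ℤ}
    (h : τ < X.arrivalTime s j) : X.F s τ < j := by
  by_contra! h'
  exact absurd (X.arrivalTime_le s hj h') (not_le.2 h)

theorem Q_eq_zero (t : ℕ) (s : S) {k : ℕ} (hk : k ∉ Finset.Icc 1 (N.hop s)) : X.Q t s k = 0 := by
  cases t with
  | zero =>
    unfold Q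
    rw [if_neg]
    rintro rfl
    exact hk (Finset.mem_Icc.2 ⟨le_rfl, N.one_le_hop s⟩)
  | succ t => unfold Q; rw [if_neg hk]

theorem Psi_zero (t : ℕ) (s : S) : X.Psi t s 0 = X.A s t := by simp [Psi, sent]

theorem Psi_of_pos (t : ℕ) (s : S) {k : ℕ} (hk : 1 ≤ k) :
    X.Psi t s k = min (X.service t s k) (X.Q t s k) := by
  simp [Psi, sent, Nat.one_le_iff_ne_zero.1 hk]

theorem service_le_one (t : ℕ) (s : S) (k : ℕ) : X.service t s k ≤ 1 := by
  unfold service; split_ifs <;> simp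

theorem service_eq_vec (t : ℕ) (p : N.Pair) :
    (X.service t p.1 p.2 : ℝ) = N.vec (X.M t) p := by
  obtain ⟨s, k, hk⟩ := p
  unfold service
  by_cases h : (⟨s, ⟨k, hk⟩⟩ : N.Pair) ∈ X.M t
  · rw [if_pos ⟨hk, h⟩]
    simp [vec, Set.indicator, h]
  · rw [if_neg (by rintro ⟨_, h'⟩; exact h h')]
    simp [vec, Set.indicator, h]

theorem Psi_le_one (t : ℕ) (s : S) {k : ℕ} (hk : 1 ≤ k) : X.Psi t s k ≤ 1 := by
  rw [X.Psi_of_pos t s hk]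
  exact (min_le_left _ _).trans (X.service_le_one t s k)

theorem Q_succ (t : ℕ) (s : S) {k : ℕ} (hk : k ∈ Finset.Icc 1 (N.hop s)) :
    X.Q (t + 1) s k + X.Psi t s k = X.Q t s k + X.Psi t s (k - 1) := by
  have h : X.Psi t s k ≤ X.Q t s k := by
    rw [X.Psi_of_pos t s (Finset.mem_Icc.1 hk).1]; exact min_le_right _ _
  conv_lhs => unfold Q
  rw [if_pos hk]
  change X.Q t s k + X.Psi t s (k - 1) - X.Psi t s k + X.Psi t s k = _
  omega

/-- Transfers between the first `k` queues cancel, and all initial packets start at hop 1, so each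
still has to pass hop `k`. -/
theorem P_add_Fhat (t : ℕ) (s : S) {k : ℕ} (hk : k ∈ Finset.Icc 1 (N.hop s)) :
    X.P t s k + X.Fhat t s k = X.F s t := by
  obtain ⟨h1, h2⟩ := Finset.mem_Icc.1 hk
  induction t with
  | zero =>
    have : X.F s ((0 : ℕ) : ℤ) = _ := X.F_zero s
    rw [this]
    simp [P, Fhat, Q, h1]
  | succ t ih =>
    have hF : X.F s ((t + 1 : ℕ) : ℤ) = X.F s t + X.A s t := by
      rw [F_natCast, F_natCast, Finset.sum_range_succ]; ring
    have hFh : X.Fhat (t + 1) s k = X.Fhat t s k + X.Psi t s k := by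
      rw [Fhat, Fhat, Finset.sum_range_succ]
    have hP : ∀ m, m ≤ N.hop s →
        X.P (t + 1) s m + X.Psi t s m = X.P t s m + X.A s t := by
      intro m
      induction m with
      | zero => intro _; simp [P, Psi_zero]
      | succ m ihm =>
        intro hm
        have := X.Q_succ t s (k := m + 1) (Finset.mem_Icc.2 ⟨by omega, hm⟩)
        have := ihm (by omega)
        simp only [P, Finset.sum_Icc_succ_top (Nat.le_add_left 1 m), Nat.add_sub_cancel] at *
        omega
    have := hP k h2
    omega

/-! ### Smoothed queues and their relation to delays. -/

variable (lam : S → ℝ)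

/-- The queue length with the arrivals before slot `t` replaced by `lam s * t`. -/
noncomputable def smoothQ (t : ℕ) (s : S) (k : ℕ) : ℝ :=
  X.Q t s k + if k = 1 then X.F s 0 + lam s * t - X.F s t else 0

/-- The total smoothed queue length of the first `k` hops. -/
noncomputable def smoothP (t : ℕ) (s : S) (k : ℕ) : ℝ := ∑ i ∈ Finset.Icc 1 k, X.smoothQ lam t s i

theorem smoothQ_of_two_le (t : ℕ) (s : S) {k : ℕ} (hk : 2 ≤ k) :
    X.smoothQ lam t s k = X.Q t s k := by
  rw [smoothQ, if_neg (by omega), add_zero]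

theorem smoothQ_hop_succ (t : ℕ) (s : S) : X.smoothQ lam t s (N.hop s + 1) = 0 := by
  have := N.one_le_hop s
  rw [smoothQ_of_two_le _ _ _ _ (by omega), X.Q_eq_zero t s (by simp), Nat.cast_zero]

theorem smoothP_succ (t : ℕ) (s : S) (k : ℕ) :
    X.smoothP lam t s (k + 1) = X.smoothP lam t s k + X.smoothQ lam t s (k + 1) := by
  rw [smoothP, Finset.sum_Icc_succ_top (Nat.le_add_left 1 k), smoothP]

theorem smoothP_eq (t : ℕ) (s : S) {k : ℕ} (hk : k ∈ Finset.Icc 1 (N.hop s)) :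
    X.smoothP lam t s k = X.F s 0 + lam s * t - X.Fhat t s k := by
  have h := X.P_add_Fhat t s hk
  have h' : (X.P t s k : ℝ) + X.Fhat t s k = X.F s t := by exact_mod_cast h
  have h1 := (Finset.mem_Icc.1 hk).1
  have h2 : X.smoothP lam t s k = X.P t s k + (X.F s 0 + lam s * t - X.F s t) := by
    simp only [smoothP, smoothQ, Finset.sum_add_distrib, P, Nat.cast_sum]
    rw [Finset.sum_ite_eq']
    simp [h1]
  rw [h2]; linarith

/-- The rate at which hop `k` feeds the smoothed queue of hop `k + 1`. -/
noncomputable def smoothPsi (t : ℕ) (s : S) (k : ℕ) : ℝ := if k = 0 then lam s else X.Psi t s k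

theorem smoothQ_succ (t : ℕ) (s : S) {k : ℕ} (hk : k ∈ Finset.Icc 1 (N.hop s)) :
    X.smoothQ lam (t + 1) s k
      = X.smoothQ lam t s k + (X.smoothPsi lam t s (k - 1) - X.smoothPsi lam t s k) := by
  have h : (X.Q (t + 1) s k : ℝ) + X.Psi t s k = X.Q t s k + X.Psi t s (k - 1) := by
    exact_mod_cast X.Q_succ t s hk
  have h1 := (Finset.mem_Icc.1 hk).1
  have hF : (X.F s ((t + 1 : ℕ) : ℤ) : ℝ) = X.F s t + X.A s t := by
    rw [F_natCast, F_natCast, Finset.sum_range_succ]; push_cast; ring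
  unfold smoothQ smoothPsi
  rw [if_neg (show k ≠ 0 by omega), hF]
  by_cases hk1 : k = 1
  · subst hk1
    simp only [Nat.sub_self, Psi_zero, if_true] at *
    push_cast
    linarith
  · rw [if_neg hk1, if_neg hk1, if_neg (by omega)]
    linarith

variable {X lam} {n : ℕ}

theorem abs_smoothQ_sub_Q_le
    (hF : ∀ s, ∀ t ≤ n, |(X.F s (t : ℕ) : ℝ) - X.F s 0 - lam s * t| ≤ X.size)
    {t : ℕ} (ht : t ≤ n) (s : S) (k : ℕ) : |X.smoothQ lam t s k - X.Q t s k| ≤ X.size := by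
  unfold smoothQ
  split_ifs
  · have := hF s t ht
    rw [abs_sub_comm] at this
    rw [add_sub_cancel_left]
    convert this using 2
    ring
  · simp

/-- Head-of-line delays are comparable to smoothed queue lengths. -/
theorem abs_W_sub_le (hpos : ∀ s, 0 < lam s) (hsize : 1 ≤ X.size)
    (hF : ∀ s, ∀ t ≤ n, |(X.F s (t : ℕ) : ℝ) - X.F s 0 - lam s * t| ≤ X.size)
    {t : ℕ} (ht : t ≤ n) (s : S) (k : ℕ) :
    |(X.W t s k : ℝ) - X.smoothP lam t s k / lam s| ≤ (1 + 1 / lam s) * X.size := by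
  have hl := hpos s
  have hx : (1 : ℝ) ≤ X.size := by exact_mod_cast hsize
  have hx0 : 0 ≤ (X.size : ℝ) / lam s := by positivity
  have hC : (1 + 1 / lam s) * (X.size : ℝ) = X.size + X.size / lam s := by ring
  rw [hC]
  induction k with
  | zero => simp [W, smoothP]; linarith
  | succ k ih =>
    by_cases h : k + 1 ≤ N.hop s ∧ X.Q t s (k + 1) ≠ 0
    · rw [W, if_pos h]
      obtain ⟨hk, hq⟩ := h
      have hmem : k + 1 ∈ Finset.Icc 1 (N.hop s) := Finset.mem_Icc.2 ⟨by omega, hk⟩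
      rw [X.smoothP_eq lam t s hmem]
      set j := X.Fhat t s (k + 1) + 1 with hj
      have hj0 : 0 < j := by omega
      have hjF : j ≤ X.F s t := by
        have h1 := X.P_add_Fhat t s hmem
        have h2 : X.Q t s (k + 1) ≤ X.P t s (k + 1) :=
          Finset.single_le_sum (f := fun i => X.Q t s i) (fun _ _ => Nat.zero_le _)
            (Finset.mem_Icc.2 ⟨by omega, le_rfl⟩)
        omega
      rw [Z, ← hj]
      set τ := X.arrivalTime s j with hτ
      have hτt : τ ≤ t := X.arrivalTime_le s hj0 hjF
      have hτF : j ≤ X.F s τ := X.le_F_arrivalTime s hj0 hjF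
      have hτF' : X.F s (τ - 1) < j := X.F_lt_of_lt_arrivalTime s hj0 (by omega)
      -- The error is the distance at time `τ` between the packet's index and the linear arrival
      -- curve, divided by `lam s`.
      have key : (((t : ℤ) - τ : ℤ) : ℝ) - (X.F s 0 + lam s * t - X.Fhat t s (k + 1)) / lam s
          = ((X.Fhat t s (k + 1) : ℝ) - X.F s 0 - lam s * τ) / lam s := by
        push_cast; field_simp; ring
      have hx' : (X.size : ℝ) + X.size / lam s = (lam s * X.size + X.size) / lam s := by
        field_simp
      rw [key, abs_div, abs_of_pos hl, hx']
      refine div_le_div_of_nonneg_right ?_ hl.le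
      have hlx : lam s ≤ lam s * X.size := le_mul_of_one_le_right hl.le hx
      -- A packet present at time 0 has `τ` in `[-size, 0]`, so both terms are O(size). A later one
      -- arrives at `τ = m + 1` with `F(m) < j ≤ F(m + 1)`, and the deviation bound applies at both
      -- ends.
      rcases le_or_gt j (X.F s 0) with hj1 | hj1
      · have h1 : τ ≤ 0 := X.arrivalTime_le s hj0 hj1
        have h2 : -(X.size : ℤ) ≤ τ := by
          by_contra! h
          have := X.F_eq_zero s h.le
          omega
        have h1' : (τ : ℝ) ≤ 0 := by exact_mod_cast h1
        have h2' : -(X.size : ℝ) ≤ τ := by exact_mod_cast h2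
        have h3 : (X.F s 0 : ℝ) ≤ X.size := by exact_mod_cast X.F_zero_le s
        have h4 : (X.Fhat t s (k + 1) : ℝ) ≤ X.F s 0 := by
          have : X.Fhat t s (k + 1) ≤ X.F s 0 := by omega
          exact_mod_cast this
        have h5 : (0 : ℝ) ≤ X.Fhat t s (k + 1) := Nat.cast_nonneg _
        have h6 := mul_le_mul_of_nonneg_left h1' hl.le
        have h7 := mul_le_mul_of_nonneg_left h2' hl.le
        rw [abs_le]
        constructor <;> linarith
      · have h1 : 0 < τ := by
          by_contra! h
          have := X.F_mono s h
          omega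
        obtain ⟨m, hm⟩ : ∃ m : ℕ, τ = (m : ℤ) + 1 := ⟨(τ - 1).toNat, by omega⟩
        have hb1 := abs_le.1 (hF s m (by omega))
        have hb2 := abs_le.1 (hF s (m + 1) (by omega))
        rw [hm] at hτF hτF' ⊢
        rw [add_sub_cancel_right] at hτF'
        have h2 : ((X.Fhat t s (k + 1) : ℕ) : ℝ) + 1 ≤ X.F s ((m + 1 : ℕ) : ℤ) := by
          exact_mod_cast hτF
        have h3 : (X.F s (m : ℤ) : ℝ) ≤ X.Fhat t s (k + 1) := by
          exact_mod_cast Nat.lt_succ_iff.1 hτF'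
        push_cast at hb1 hb2 h2 ⊢
        rw [abs_le]
        constructor <;> linarith
    · have hq : X.Q t s (k + 1) = 0 := by
        by_contra hq
        by_cases hk : k + 1 ≤ N.hop s
        · exact h ⟨hk, hq⟩
        · exact hq (X.Q_eq_zero t s (by simp; omega))
      rw [W, if_neg h, smoothP_succ]
      -- An empty first queue has delay 0 but may keep a smoothed length of up to `size`; beyond hop
      -- 1 an empty queue changes neither side.
      cases k with
      | zero =>
        have := abs_smoothQ_sub_Q_le hF ht s 1
        rw [hq] at this
        simp only [W, smoothP, Int.cast_zero, zero_sub, abs_neg]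
        simp only [Nat.cast_zero, sub_zero] at this
        simp only [zero_add, Finset.Icc_eq_empty (show ¬ (1 ≤ 0) by omega), Finset.sum_empty]
        rw [abs_div, abs_of_pos hl]
        have := div_le_div_of_nonneg_right this hl.le
        linarith
      | succ k =>
        rw [smoothQ_of_two_le _ _ _ _ (by omega), hq]
        simpa using ih

end SamplePath
end DelayBP.Network

/-! ### Lyapunov drift and boundedness. -/

namespace DelayBP.Network

variable {S : Type*} {N : Network S}

theorem sum_pair [Fintype S] (g : S → ℕ → ℝ) :
    ∑ p : N.Pair, g p.1 p.2 = ∑ s, ∑ k ∈ Finset.Icc 1 (N.hop s), g s k := by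
  rw [Fintype.sum_sigma]
  refine Finset.sum_congr rfl fun s _ => ?_
  exact Finset.sum_coe_sort (Finset.Icc 1 (N.hop s)) (g s)

/-- Summation by parts along a route. -/
theorem sum_Icc_by_parts (y a : ℕ → ℝ) (H : ℕ) :
    ∑ k ∈ Finset.Icc 1 H, y k * (a (k - 1) - a k) + ∑ k ∈ Finset.Icc 1 H, (y k - y (k + 1)) * a k
      = y 1 * a 0 - y (H + 1) * a H := by
  induction H with
  | zero => simp
  | succ H ih =>
    rw [Finset.sum_Icc_succ_top (Nat.le_add_left 1 H), Finset.sum_Icc_succ_top (Nat.le_add_left 1 H)]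
    simp only [Nat.add_sub_cancel]
    linarith

namespace SamplePath

variable [Fintype S] {X : N.SamplePath} {lam : S → ℝ} {n : ℕ}

variable (X lam) in
/-- The difference of consecutive smoothed queue lengths in units of delay. -/
noncomputable def smoothDiff (t : ℕ) (p : N.Pair) : ℝ :=
  (X.smoothQ lam t p.1 p.2 - X.smoothQ lam t p.1 (p.2 + 1)) / lam p.1

variable (X lam) in
/-- The quadratic Lyapunov function of the smoothed queue lengths. -/
noncomputable def lyapunov (t : ℕ) : ℝ := ∑ p : N.Pair, X.smoothQ lam t p.1 p.2 ^ 2 / lam p.1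

/-- The differential is the second difference `2 W_k - W_{k-1} - W_{k+1}`, hence four times the
error of one delay. -/
theorem abs_dWhat_sub_le (hpos : ∀ s, 0 < lam s) (hsize : 1 ≤ X.size)
    (hF : ∀ s, ∀ t ≤ n, |(X.F s (t : ℕ) : ℝ) - X.F s 0 - lam s * t| ≤ X.size)
    {t : ℕ} (ht : t ≤ n) (p : N.Pair) :
    |(X.dWhat t p.1 p.2 : ℝ) - X.smoothDiff lam t p| ≤ 4 * ((1 + 1 / lam p.1) * X.size) := by
  obtain ⟨s, k, hk⟩ := p
  obtain ⟨m, rfl⟩ : ∃ m, k = m + 1 := ⟨k - 1, by have := (Finset.mem_Icc.1 hk).1; omega⟩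
  have h0 := abs_le.1 (abs_W_sub_le hpos hsize hF ht s m)
  have h1 := abs_le.1 (abs_W_sub_le hpos hsize hF ht s (m + 1))
  have h2 := abs_le.1 (abs_W_sub_le hpos hsize hF ht s (m + 1 + 1))
  rw [smoothP_succ] at h2
  rw [smoothP_succ] at h1 h2
  simp only [dWhat, What, smoothDiff, Nat.add_sub_cancel, add_div, sub_div] at *
  push_cast
  rw [abs_le]
  constructor <;> linarith

/-- Offered service is wasted only on an empty queue, whose smoothed length is at most `size`; the
next queue is nonnegative, so the lost weight is small. -/
theorem smoothDiff_mul_service_le (hpos : ∀ s, 0 < lam s)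
    (hF : ∀ s, ∀ t ≤ n, |(X.F s (t : ℕ) : ℝ) - X.F s 0 - lam s * t| ≤ X.size)
    {t : ℕ} (ht : t ≤ n) (p : N.Pair) :
    X.smoothDiff lam t p * N.vec (X.M t) p
      ≤ X.smoothDiff lam t p * X.Psi t p.1 p.2 + X.size / lam p.1 := by
  rw [← service_eq_vec]
  obtain ⟨s, k, hk⟩ := p
  have hl := hpos s
  have hk1 := (Finset.mem_Icc.1 hk).1
  simp only
  rw [X.Psi_of_pos t s hk1]
  have hx : 0 ≤ (X.size : ℝ) / lam s := by positivity
  have hs := X.service_le_one t s k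
  rcases Nat.eq_zero_or_pos (X.Q t s k) with hq | hq
  · have h1 := (abs_le.1 (abs_smoothQ_sub_Q_le hF ht s k)).2
    rw [hq, Nat.cast_zero, sub_zero] at h1
    have hD : X.smoothDiff lam t ⟨s, k, hk⟩ ≤ X.size / lam s := by
      refine div_le_div_of_nonneg_right ?_ hl.le
      simp only
      rw [X.smoothQ_of_two_le lam t s (k := k + 1) (by omega)]
      have : (0 : ℝ) ≤ X.Q t s (k + 1) := Nat.cast_nonneg _
      linarith
    rw [hq, Nat.min_zero, Nat.cast_zero, mul_zero, zero_add]
    have h0 : (0 : ℝ) ≤ X.service t s k := Nat.cast_nonneg _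
    have hs' : (X.service t s k : ℝ) ≤ 1 := by exact_mod_cast hs
    nlinarith
  · rw [min_eq_left (hs.trans hq)]
    linarith

variable (N lam) in
/-- A bound, relative to the initial number of packets, for the upward drift. -/
noncomputable def driftConst : ℝ :=
  ∑ p : N.Pair, (2 / lam p.1 + 16 * (1 + 1 / lam p.1) + (1 + lam p.1) ^ 2 / lam p.1)

/-- The Lyapunov drift under delay-based back-pressure. -/
theorem lyapunov_succ_le (hpos : ∀ s, 0 < lam s) {eps : ℝ} (heps : 0 < eps) {phi : N.Pair → ℝ}
    (hphi : phi ∈ N.scheduleHull) (hle : ∀ p : N.Pair, lam p.1 * (1 + eps * (p.2 : ℕ)) ≤ phi p)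
    (hX : X.IsDBP) (hsize : 1 ≤ X.size)
    (hF : ∀ s, ∀ t ≤ n, |(X.F s (t : ℕ) : ℝ) - X.F s 0 - lam s * t| ≤ X.size)
    {t : ℕ} (ht : t ≤ n) :
    X.lyapunov lam (t + 1) ≤ X.lyapunov lam t
      - 2 * eps * ∑ p : N.Pair, X.smoothQ lam t p.1 p.2 + driftConst N lam * X.size := by
  have hx : (1 : ℝ) ≤ X.size := by exact_mod_cast hsize
  have hmax := sum_mul_le_of_approx_max (M₀ := X.M t) hphi
    (fun p => mul_nonneg (hpos p.1).le (by positivity)) hle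
    (abs_dWhat_sub_le hpos hsize hF ht) (hX t).2
  have hserv : ∑ p : N.Pair, X.smoothDiff lam t p * N.vec (X.M t) p
      ≤ ∑ p : N.Pair, X.smoothDiff lam t p * X.Psi t p.1 p.2
        + ∑ p : N.Pair, (X.size : ℝ) / lam p.1 := by
    rw [← Finset.sum_add_distrib]
    exact Finset.sum_le_sum fun p _ => smoothDiff_mul_service_le hpos hF ht p
  -- Summation by parts: the increments `eps` yield the total backlog, and the value 1 at `k = 0`
  -- yields a boundary term that cancels the arrival term of `hflow`.
  have hphi' : ∑ p : N.Pair, X.smoothDiff lam t p * (lam p.1 * (1 + eps * (p.2 : ℕ)))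
      = ∑ s, X.smoothQ lam t s 1 + eps * ∑ p : N.Pair, X.smoothQ lam t p.1 p.2 := by
    simp only [smoothDiff]
    rw [sum_pair (fun s k => X.smoothQ lam t s k), Finset.mul_sum, ← Finset.sum_add_distrib,
      sum_pair (fun s k => (X.smoothQ lam t s k - X.smoothQ lam t s (k + 1)) / lam s
        * (lam s * (1 + eps * k)))]
    refine Finset.sum_congr rfl fun s _ => ?_
    have h := sum_Icc_by_parts (X.smoothQ lam t s) (fun k => 1 + eps * k) (N.hop s)
    rw [smoothQ_hop_succ] at h
    have h1 : ∑ k ∈ Finset.Icc 1 (N.hop s), X.smoothQ lam t s k *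
        ((1 + eps * ((k - 1 : ℕ) : ℝ)) - (1 + eps * (k : ℝ)))
        = - (eps * ∑ k ∈ Finset.Icc 1 (N.hop s), X.smoothQ lam t s k) := by
      rw [Finset.mul_sum, ← Finset.sum_neg_distrib]
      refine Finset.sum_congr rfl fun k hk => ?_
      rw [Nat.cast_sub (Finset.mem_Icc.1 hk).1]
      push_cast
      ring
    have h2 : ∑ k ∈ Finset.Icc 1 (N.hop s),
        (X.smoothQ lam t s k - X.smoothQ lam t s (k + 1)) / lam s * (lam s * (1 + eps * k))
        = ∑ k ∈ Finset.Icc 1 (N.hop s),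
          (X.smoothQ lam t s k - X.smoothQ lam t s (k + 1)) * (1 + eps * k) := by
      refine Finset.sum_congr rfl fun k _ => ?_
      have := (hpos s).ne'
      field_simp
    simp only [h1] at h
    rw [h2]
    simp only [Nat.cast_zero] at h
    linarith
  have hflow : ∑ p : N.Pair, X.smoothQ lam t p.1 p.2
        * (X.smoothPsi lam t p.1 (p.2 - 1) - X.smoothPsi lam t p.1 p.2) / lam p.1
      = ∑ s, X.smoothQ lam t s 1 - ∑ p : N.Pair, X.smoothDiff lam t p * X.Psi t p.1 p.2 := by
    simp only [smoothDiff]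
    rw [sum_pair (fun s k => X.smoothQ lam t s k
        * (X.smoothPsi lam t s (k - 1) - X.smoothPsi lam t s k) / lam s),
      sum_pair (fun s k => (X.smoothQ lam t s k - X.smoothQ lam t s (k + 1)) / lam s * X.Psi t s k),
      ← Finset.sum_sub_distrib]
    refine Finset.sum_congr rfl fun s _ => ?_
    have h := sum_Icc_by_parts (X.smoothQ lam t s) (X.smoothPsi lam t s) (N.hop s)
    rw [smoothQ_hop_succ, zero_mul, sub_zero] at h
    have h1 : ∑ k ∈ Finset.Icc 1 (N.hop s),
        (X.smoothQ lam t s k - X.smoothQ lam t s (k + 1)) / lam s * X.Psi t s k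
        = (∑ k ∈ Finset.Icc 1 (N.hop s),
          (X.smoothQ lam t s k - X.smoothQ lam t s (k + 1)) * X.smoothPsi lam t s k) / lam s := by
      rw [Finset.sum_div]
      refine Finset.sum_congr rfl fun k hk => ?_
      have : k ≠ 0 := by have := (Finset.mem_Icc.1 hk).1; omega
      rw [smoothPsi, if_neg this]
      ring
    rw [h1, ← Finset.sum_div, eq_sub_iff_add_eq, ← add_div, h, smoothPsi, if_pos rfl,
      mul_div_cancel_right₀ _ (hpos s).ne']
  have hstep : X.lyapunov lam (t + 1) ≤ X.lyapunov lam t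
      + 2 * ∑ p : N.Pair, X.smoothQ lam t p.1 p.2
        * (X.smoothPsi lam t p.1 (p.2 - 1) - X.smoothPsi lam t p.1 p.2) / lam p.1
      + ∑ p : N.Pair, (1 + lam p.1) ^ 2 / lam p.1 := by
    rw [lyapunov, lyapunov, Finset.mul_sum, ← Finset.sum_add_distrib, ← Finset.sum_add_distrib]
    refine Finset.sum_le_sum fun p _ => ?_
    obtain ⟨s, k, hk⟩ := p
    simp only
    have hl := hpos s
    rw [X.smoothQ_succ lam t s hk]
    have hb : ∀ k, 0 ≤ X.smoothPsi lam t s k ∧ X.smoothPsi lam t s k ≤ 1 + lam s := by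
      intro k
      unfold smoothPsi
      split_ifs with h
      · constructor <;> linarith
      · have : (X.Psi t s k : ℝ) ≤ 1 := by
          exact_mod_cast X.Psi_le_one t s (Nat.one_le_iff_ne_zero.2 h)
        exact ⟨Nat.cast_nonneg _, by linarith⟩
    set d := X.smoothPsi lam t s (k - 1) - X.smoothPsi lam t s k with hd
    have hd2 : d ^ 2 ≤ (1 + lam s) ^ 2 := by
      refine sq_le_sq' ?_ ?_ <;> linarith [hb k, hb (k - 1)]
    have h1 := div_le_div_of_nonneg_right hd2 hl.le
    have h2 : (X.smoothQ lam t s k + d) ^ 2 / lam s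
        = X.smoothQ lam t s k ^ 2 / lam s + 2 * (X.smoothQ lam t s k * d / lam s)
          + d ^ 2 / lam s := by ring
    linarith
  -- Here 16 is 2 from the square, times 2 from approximate maximality, times 4 from the
  -- differential; the other terms are wasted service and the squared increment.
  have hC : ∑ p : N.Pair, (1 + lam p.1) ^ 2 / lam p.1
      + 2 * ∑ p : N.Pair, (X.size : ℝ) / lam p.1
      + 4 * ∑ p : N.Pair, 4 * ((1 + 1 / lam p.1) * (X.size : ℝ))
      ≤ driftConst N lam * X.size := by
    rw [driftConst, Finset.sum_mul, Finset.mul_sum, Finset.mul_sum, ← Finset.sum_add_distrib,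
      ← Finset.sum_add_distrib]
    refine Finset.sum_le_sum fun p _ => ?_
    have hl := hpos p.1
    have h0 : 0 ≤ (1 + lam p.1) ^ 2 / lam p.1 := by positivity
    have := le_mul_of_one_le_right h0 hx
    have e : (2 / lam p.1 + 16 * (1 + 1 / lam p.1) + (1 + lam p.1) ^ 2 / lam p.1) * X.size
      = 2 * (X.size / lam p.1) + 16 * ((1 + 1 / lam p.1) * X.size)
        + (1 + lam p.1) ^ 2 / lam p.1 * X.size := by ring
    linarith
  rw [hflow] at hstep
  rw [hphi'] at hmax
  linarith

/-- The Lyapunov function stays bounded, relative to the squared initial number of packets. -/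
theorem exists_lyapunov_le (hpos : ∀ s, 0 < lam s) (hlam : N.StrictlyInside lam) :
    ∃ B : ℝ, 0 ≤ B ∧ ∀ (X : N.SamplePath) (n : ℕ), X.IsDBP → 1 ≤ X.size →
      (∀ s, ∀ t ≤ n, |(X.F s (t : ℕ) : ℝ) - X.F s 0 - lam s * t| ≤ X.size) →
      ∀ t ≤ n, X.lyapunov lam t ≤ B * X.size ^ 2 := by
  obtain ⟨eps, heps, phi, hphi, hle⟩ := hlam.exists_pos_le
  set c := driftConst N lam with hc
  have hc0 : 0 ≤ c := Finset.sum_nonneg fun p _ => by have := hpos p.1; positivity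
  set m : ℝ := ((Fintype.card N.Pair : ℕ) : ℝ) with hm
  have hm0 : 0 ≤ m := Nat.cast_nonneg _
  -- Without negative drift the sum is at most `c / (2 * eps) * size`. As each term is at least
  -- `-size`, every single one is then at most `(c / (2 * eps) + m) * size`; the 1 covers the lower
  -- bound and time 0.
  set K : ℝ := c / (2 * eps) + m + 1 with hK
  have hK1 : 1 ≤ K := by have : 0 ≤ c / (2 * eps) := by positivity
                         linarith
  set R : ℝ := ∑ p : N.Pair, K ^ 2 / lam p.1 with hR
  have hR0 : 0 ≤ R := Finset.sum_nonneg fun p _ => by have := hpos p.1; positivity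
  refine ⟨R + 2 * eps * m + c, by positivity, fun X n hX hsize hF t ht => ?_⟩
  have hx : (1 : ℝ) ≤ X.size := by exact_mod_cast hsize
  have hx2 : (X.size : ℝ) ≤ X.size ^ 2 := by nlinarith
  have hsmall : ∀ t, (∀ p : N.Pair, |X.smoothQ lam t p.1 p.2| ≤ K * X.size) →
      X.lyapunov lam t ≤ R * X.size ^ 2 := by
    intro t h
    rw [hR, Finset.sum_mul, lyapunov]
    refine Finset.sum_le_sum fun p _ => ?_
    have h1 := sq_le_sq' (abs_le.1 (h p)).1 (abs_le.1 (h p)).2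
    have h2 := div_le_div_of_nonneg_right h1 (hpos p.1).le
    calc _ ≤ _ := h2
      _ = _ := by ring
  induction t with
  | zero =>
    have h1 := hsmall 0 fun p => by
      have h2 : X.Q 0 p.1 p.2 ≤ X.size := by
        unfold Q
        split_ifs
        · rw [← F_zero]; exact X.F_zero_le p.1
        · exact Nat.zero_le _
      have h2' : (X.Q 0 p.1 p.2 : ℝ) ≤ X.size := by exact_mod_cast h2
      have h3 : X.smoothQ lam 0 p.1 p.2 = X.Q 0 p.1 p.2 := by simp [smoothQ]
      rw [h3, abs_of_nonneg (Nat.cast_nonneg _)]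
      nlinarith
    have : 0 ≤ (2 * eps * m + c) * (X.size : ℝ) ^ 2 := by positivity
    linarith
  | succ t ih =>
    have ht' : t ≤ n := by omega
    have hV := ih ht'
    have hdrift := lyapunov_succ_le hpos heps hphi hle hX hsize hF ht'
    have hlow : ∀ p : N.Pair, -(X.size : ℝ) ≤ X.smoothQ lam t p.1 p.2 := by
      intro p
      have h1 := (abs_le.1 (abs_smoothQ_sub_Q_le hF ht' p.1 p.2)).1
      have h2 : (0 : ℝ) ≤ X.Q t p.1 p.2 := Nat.cast_nonneg _
      linarith
    -- Either the function does not increase, or it is at most `R * size ^ 2` and one step adds at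
    -- most `(2 * eps * m + c) * size`.
    by_cases hbig : c * X.size ≤ 2 * eps * ∑ p : N.Pair, X.smoothQ lam t p.1 p.2
    · linarith
    · push Not at hbig
      have hsum : ∑ p : N.Pair, X.smoothQ lam t p.1 p.2 ≤ c / (2 * eps) * X.size := by
        rw [div_mul_eq_mul_div, le_div_iff₀ (by positivity)]
        linarith
      have hshift : ∀ p : N.Pair, X.smoothQ lam t p.1 p.2 + X.size
          ≤ ∑ p : N.Pair, X.smoothQ lam t p.1 p.2 + m * X.size := by
        intro p
        have h1 := Finset.single_le_sum (f := fun p : N.Pair => X.smoothQ lam t p.1 p.2 + X.size)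
          (fun p _ => by linarith [hlow p]) (Finset.mem_univ p)
        rw [Finset.sum_add_distrib, Finset.sum_const, Finset.card_univ, nsmul_eq_mul] at h1
        exact h1
      have hmx : 0 ≤ m * X.size := by positivity
      have hV' := hsmall t fun p => by
        have := hshift p
        have h2 : 0 ≤ c / (2 * eps) * X.size := by positivity
        rw [hK, abs_le, add_mul, add_mul]
        constructor
        · linarith [hlow p]
        · linarith
      have hsum' : -(m * X.size) ≤ ∑ p : N.Pair, X.smoothQ lam t p.1 p.2 := by
        have h1 : ∑ _p : N.Pair, -(X.size : ℝ) ≤ ∑ p : N.Pair, X.smoothQ lam t p.1 p.2 :=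
          Finset.sum_le_sum fun p _ => hlow p
        rwa [Finset.sum_const, Finset.card_univ, nsmul_eq_mul, mul_neg] at h1
      have h3 : 2 * eps * -(m * X.size) ≤ 2 * eps * ∑ p : N.Pair, X.smoothQ lam t p.1 p.2 :=
        mul_le_mul_of_nonneg_left hsum' (by positivity)
      have h4 : (2 * eps * m + c) * X.size ≤ (2 * eps * m + c) * X.size ^ 2 :=
        mul_le_mul_of_nonneg_left hx2 (by positivity)
      linarith

/-- At every hop the number of served packets stays within a bounded multiple of the initial number
of packets of its fluid value. -/
theorem exists_le_Fhat (hpos : ∀ s, 0 < lam s) (hlam : N.StrictlyInside lam) :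
    ∃ B : ℝ, 0 ≤ B ∧ ∀ (X : N.SamplePath) (n : ℕ), X.IsDBP → 1 ≤ X.size →
      (∀ s, ∀ t ≤ n, |(X.F s (t : ℕ) : ℝ) - X.F s 0 - lam s * t| ≤ X.size) →
      ∀ t ≤ n, ∀ p : N.Pair, X.F p.1 0 + lam p.1 * t - B * X.size ≤ X.Fhat t p.1 p.2 := by
  obtain ⟨B, hB, h⟩ := exists_lyapunov_le hpos hlam
  have hterm : ∀ p : N.Pair, 0 ≤ B * lam p.1 + 1 := fun p => by have := hpos p.1; positivity
  refine ⟨∑ p : N.Pair, (B * lam p.1 + 1), Finset.sum_nonneg fun p _ => hterm p,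
    fun X n hX hsize hF t ht p => ?_⟩
  have hV := h X n hX hsize hF t ht
  have hq : ∀ p : N.Pair, X.smoothQ lam t p.1 p.2 ≤ (B * lam p.1 + 1) * X.size := by
    intro p
    have hl := hpos p.1
    have h1 : X.smoothQ lam t p.1 p.2 ^ 2 / lam p.1 ≤ X.lyapunov lam t :=
      Finset.single_le_sum (f := fun p : N.Pair => X.smoothQ lam t p.1 p.2 ^ 2 / lam p.1)
        (fun p _ => by have := hpos p.1; positivity) (Finset.mem_univ p)
    have h2 : X.smoothQ lam t p.1 p.2 ^ 2 ≤ B * X.size ^ 2 * lam p.1 :=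
      (div_le_iff₀ hl).1 (h1.trans hV)
    refine le_of_abs_le (abs_le_of_sq_le_sq ?_ (mul_nonneg (hterm p) (Nat.cast_nonneg _)))
    have h3 : 0 ≤ B * lam p.1 := by positivity
    have h4 : B * lam p.1 ≤ (B * lam p.1 + 1) ^ 2 := by nlinarith
    have h5 := mul_le_mul_of_nonneg_right h4 (sq_nonneg (X.size : ℝ))
    rw [mul_pow]
    linarith
  have hP : X.smoothP lam t p.1 p.2 ≤ (∑ p : N.Pair, (B * lam p.1 + 1)) * X.size := by
    rw [Finset.sum_mul, sum_pair (fun s _ => (B * lam s + 1) * (X.size : ℝ))]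
    have hnn : ∀ s, 0 ≤ (B * lam s + 1) * (X.size : ℝ) := fun s => by
      have := hpos s; positivity
    calc X.smoothP lam t p.1 p.2
        ≤ ∑ k ∈ Finset.Icc 1 (p.2 : ℕ), (B * lam p.1 + 1) * (X.size : ℝ) :=
          Finset.sum_le_sum fun k hk => hq ⟨p.1, k, Finset.mem_Icc.2
            ⟨(Finset.mem_Icc.1 hk).1,
              (Finset.mem_Icc.1 hk).2.trans (Finset.mem_Icc.1 p.2.2).2⟩⟩
      _ ≤ ∑ k ∈ Finset.Icc 1 (N.hop p.1), (B * lam p.1 + 1) * (X.size : ℝ) :=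
          Finset.sum_le_sum_of_subset_of_nonneg
            (Finset.Icc_subset_Icc_right (Finset.mem_Icc.1 p.2.2).2) fun _ _ _ => hnn _
      _ ≤ _ := Finset.single_le_sum
          (f := fun s => ∑ k ∈ Finset.Icc 1 (N.hop s), (B * lam s + 1) * (X.size : ℝ))
          (fun s _ => Finset.sum_nonneg fun _ _ => hnn s) (Finset.mem_univ p.1)
  rw [X.smoothP_eq lam t p.1 p.2.2] at hP
  linarith

end SamplePath
end DelayBP.Network

/-! ### Passage to the fluid scale. -/

namespace DelayBP

theorem intervalIntegrable_floor_and_integral (Y : ℕ → ℝ) (n : ℕ) :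
    IntervalIntegrable (fun τ : ℝ => Y ⌊τ⌋₊) volume 0 n ∧
      ∫ τ in (0 : ℝ)..n, Y ⌊τ⌋₊ = ∑ i ∈ Finset.range n, Y i := by
  induction n with
  | zero => simp
  | succ n ih =>
    have hae : (fun _ : ℝ => Y n) =ᵐ[volume.restrict (Set.uIoc (n : ℝ) (n + 1))]
        fun τ : ℝ => Y ⌊τ⌋₊ := by
      rw [Set.uIoc_of_le (by linarith), ← restrict_Ioo_eq_restrict_Ioc]
      filter_upwards [ae_restrict_mem measurableSet_Ioo] with τ hτ
      rw [(Nat.floor_eq_iff (n.cast_nonneg.trans hτ.1.le)).2 ⟨hτ.1.le, hτ.2⟩]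
    have hint : IntervalIntegrable (fun τ : ℝ => Y ⌊τ⌋₊) volume n (n + 1) :=
      intervalIntegrable_const.congr_ae hae
    push_cast
    refine ⟨ih.1.trans hint, ?_⟩
    rw [← intervalIntegral.integral_add_adjacent_intervals ih.1 hint, ih.2,
      Finset.sum_range_succ, ← intervalIntegral.integral_congr_ae_restrict hae]
    simp

theorem scaledIntegral_div {x : ℕ} (hx : 1 ≤ x) (Y : ℕ → ℝ) (t : ℕ) :
    scaledIntegral x Y (t / x) = (∑ i ∈ Finset.range t, Y i) / x := by
  have hx' : (x : ℝ) ≠ 0 := by positivity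
  rw [scaledIntegral, mul_div_cancel₀ _ hx', (intervalIntegrable_floor_and_integral Y t).2]

theorem UOC.tendsto {g : ℕ → ℝ → ℝ} {g' : ℝ → ℝ} (h : UOC g g') {t : ℝ} (ht : 0 ≤ t) :
    Tendsto (fun j => g j t) atTop (𝓝 (g' t)) :=
  (h t).tendsto_at ⟨ht, le_rfl⟩

/-- If the scaled arrival processes converge, then for large initial numbers of packets the
arrivals up to a given scaled time deviate little from their mean. -/
theorem eventually_abs_sum_sub_le {A : ℕ → ℕ → ℕ} {l : ℝ}
    (h : UOC (fun x => scaledIntegral x fun t => A x t) fun t => l * t) (T : ℝ) :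
    ∀ᶠ x : ℕ in atTop, ∀ t ≤ ⌊(x : ℝ) * T⌋₊, |(∑ i ∈ Finset.range t, A x i : ℝ) - l * t| ≤ x := by
  filter_upwards [Metric.tendstoUniformlyOn_iff.1 (h T) 1 one_pos, eventually_ge_atTop 1]
    with x hx hx1 t ht
  have hx0 : (0 : ℝ) < x := by exact_mod_cast hx1
  -- For negative `T` the floor is 0, so `t = 0` needs separate treatment.
  rcases Nat.eq_zero_or_pos t with rfl | htpos
  · simp
  have ht' : (t : ℝ) ≤ x * T := (Nat.le_floor_iff' htpos.ne').1 ht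
  have h1 := hx (t / x) ⟨by positivity, (div_le_iff₀ hx0).2 (by linarith)⟩
  rw [scaledIntegral_div hx1, Real.dist_eq, abs_sub_comm, ← mul_div_assoc, ← sub_div, abs_div,
    abs_of_pos hx0, div_lt_one hx0] at h1
  exact h1.le

end DelayBP

theorem lemma4 {S : Type*} [Fintype S] (N : DelayBP.Network S) (lam : S → ℝ)
    (hpos : ∀ s, 0 < lam s) (hlam : N.StrictlyInside lam) :
    ∃ T : ℝ, 0 < T ∧
      ∀ (Ω : Type*) [MeasurableSpace Ω] (μ : Measure Ω) [IsProbabilityMeasure μ]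
        -- `A x ω s t`: arrivals of flow `s` in slot `t`, in the systems started with `x` packets
        (A : ℕ → Ω → S → ℕ → ℕ),
        -- strong law of large numbers
        (∀ x s, ∀ᵐ ω ∂μ, Tendsto
          (fun t : ℕ => (∑ τ ∈ Finset.range t, (A x ω s τ : ℝ)) / t) atTop (𝓝 (lam s))) →
        -- existence of the fluid limits of the arrival processes
        (∀ s, ∀ᵐ ω ∂μ, DelayBP.UOC
          (fun x => DelayBP.scaledIntegral x fun t => A x ω s t) (fun t => lam s * t)) →
        ∀ᵐ ω ∂μ, ∀ X : ℕ → N.SamplePath,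
          (∀ n, (X n).A = A (X n).size ω) →
          (∀ n, (X n).IsDBP) →
          Tendsto (fun n => (X n).size) atTop atTop →
          ∀ L : N.FluidFunctions, DelayBP.IsFluidLimit X L →
            ∀ p : N.Pair, L.f p.1 0 < L.fhat p T := by
  obtain ⟨B, hB, hFhat⟩ := DelayBP.Network.SamplePath.exists_le_Fhat hpos hlam
  -- The sum dominates every `B / lam s`, and the 1 makes the inequality strict.
  set T : ℝ := ∑ s, B / lam s + 1 with hT
  have hterm : ∀ s, 0 ≤ B / lam s := fun s => by have := hpos s; positivity
  have hT0 : 0 < T := by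
    have := Finset.sum_nonneg fun s (_ : s ∈ Finset.univ) => hterm s
    linarith
  refine ⟨T, hT0, fun Ω _ μ _ A _ hA => ?_⟩
  filter_upwards [ae_all_iff.2 hA] with ω hω X hXA hX hsize L hL p
  obtain ⟨σ, hσ, hf, hr⟩ := hL
  have hsize' : Tendsto (fun j => (X (σ j)).size) atTop atTop := hsize.comp hσ.tendsto_atTop
  have hf0 := (hf p.1).tendsto le_rfl
  have hfhat := (hr p).1.tendsto hT0.le
  have hev : ∀ᶠ x : ℕ in atTop, ∀ s, ∀ t ≤ ⌊(x : ℝ) * T⌋₊,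
      |(∑ i ∈ Finset.range t, A x ω s i : ℝ) - lam s * t| ≤ x :=
    eventually_all.2 fun s => DelayBP.eventually_abs_sum_sub_le (hω s) T
  -- Rounding `x * T` down to a slot costs at most `lam / x` after scaling.
  have hinv : Tendsto (fun j => lam p.1 / ((X (σ j)).size : ℝ)) atTop (𝓝 0) :=
    tendsto_const_nhds.div_atTop (tendsto_natCast_atTop_atTop.comp hsize')
  have hlim := (hf0.add_const (lam p.1 * T - B)).sub hinv
  have hle := le_of_tendsto_of_tendsto hlim hfhat (by
    filter_upwards [hsize'.eventually hev, hsize'.eventually_ge_atTop 1] with j hj hj1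
    have hx0 : (0 : ℝ) < (X (σ j)).size := by exact_mod_cast hj1
    have h := hFhat (X (σ j)) _ (hX _) hj1 (fun s t ht => by
      have := hj s t ht
      rw [DelayBP.Network.SamplePath.F_natCast, DelayBP.Network.SamplePath.F_zero, hXA]
      push_cast
      rwa [add_sub_cancel_left]) _ le_rfl p
    have hfl : ((X (σ j)).size : ℝ) * T - 1 ≤ ⌊((X (σ j)).size : ℝ) * T⌋₊ :=
      (Nat.sub_one_lt_floor _).le
    have hfl' := mul_le_mul_of_nonneg_left hfl (hpos p.1).le
    simp only [DelayBP.scaled, mul_zero, Nat.floor_zero, Nat.cast_zero]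
    rw [le_div_iff₀ hx0]
    have e : (((X (σ j)).F p.1 0 : ℝ) / (X (σ j)).size + (lam p.1 * T - B)
        - lam p.1 / (X (σ j)).size) * (X (σ j)).size
        = (X (σ j)).F p.1 0 + lam p.1 * ((X (σ j)).size * T - 1) - B * (X (σ j)).size := by
      field_simp
      ring
    rw [e]
    linarith)
  have hlamT : B < lam p.1 * T := by
    have h1 : B / lam p.1 < T := by
      have := Finset.single_le_sum (f := fun s => B / lam s) (fun s _ => hterm s)
        (Finset.mem_univ p.1)
      linarith
    rw [mul_comm]
    exact (div_lt_iff₀ (hpos p.1)).1 h1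
  linarith
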